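/- **Setting.** A dataset $X=(X_1,\dots,X_n)\in\mathcal Z^n$ consists of $n$ private records. Let $d(X,Y)$ be the number of coordinates in which $X$ and $Y$ differ, and write $X\simeq X'$ (neighbours) if $d(X,X')\le 1$. A randomized algorithm $\mathcal M$ satisfies $(\epsilon,\delta)$-DP if $\Pr[\mathcal M(X)\in S]\le e^{\epsilon}\Pr[\mathcal M(X')\in S]+\delta$ for all $X\simeq X'$ and all measurable $S$. For $\alpha>1$, let $D_\alpha(P\|Q)=\frac{1}{\alpha-1}\log \mathbb E_{o\sim Q}\big[(\tfrac{dP}{dQ}(o))^{\alpha}\big]$ if $P\ll Q$, and $D_\alpha(P\|Q)=\infty$ otherwise. A function $r:\mathcal Z^n\to\mathbb R$ is a *data-dependent RDP function* of order $\alpha$ for $\mathcal M$ if $D_\alpha(\mathcal M(X)\|\mathcal M(X'))\le r(X)$ for all $X\simeq X'$; the smallest one is $r(X)=\sup_{X'\simeq X}D_\alpha(\mathcal M(X)\|\mathcal M(X'))$. For $f:\mathcal Z^n\to\mathbb R$ let $\Delta_{LS}(Y)=\sup_{Y'\simeq Y}|f(Y)-f(Y')|$. The *$\beta$-smooth sensitivity*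 of $f$ is $SS_\beta(X)=\sup_{d\ge 0}e^{-\beta d}\sup_{Y:\,d(X,Y)\le d}\Delta_{LS}(Y)$. More generally, $SS:\mathcal Z^n\to\mathbb R$ is a *$\beta$-smooth sensitivity bound* of $f$ if $|f(X)-f(X')|\le SS(X)$ and $SS(X)\le e^{\beta}SS(X')$ for all $X\simeq X'$. The records are split into $K$ disjoint shards, and teacher $k$ is a classifier into $C\ge 1$ classes trained on shard $k$ only. Let $x_1,\dots,x_T$ be unlabeled public points, and let $n_j(x_i)$ be the number of teachers that predict class $j$ at $x_i$. A (possibly randomized) training procedure turns labels $y_{1:T}$ of $x_{1:T}$ into a student model, and has no other access to the private data. **Algorithm (PATE with generalized PTR).** The parameters are $\sigma_1>0$, $\epsilon'\ge 0$, $\hat\epsilon>0$ and $0<\delta<1$. Put $$\alpha=\frac{2\log(2/\delta)}{\hat\epsilon}+1,\qquad \sigma_s=\sigma_2=\sqrt{\frac{3\alpha+2}{\hat\epsilon}},\qquad \delta_2=\frac{\delta}{2},\qquad \beta=\frac{0.2}{\alpha}.$$ 1. Draw noisy labels $y_i=\operatorname{argmax}_{j\in[C]}\{n_j(x_i)+\mathcal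 N(0,\sigma_1^2)\}$ for $i\in[T]$, with independent noises. 2. Let $\mathrm{RDP}(\alpha,X)$ be the data-dependent RDP of order $\alpha$ of releasing $y_{1:T}$, and let $SS_\beta(X)$ be the $\beta$-smooth sensitivity of $X\mapsto\mathrm{RDP}(\alpha,X)$. 3. With independent noises $z_2\sim\mathcal N(0,\sigma_2^2)$ and $z_s\sim\mathcal N(0,\sigma_s^2)$, which are also independent of the labels and of the training of the student, release $$\mu=\log SS_\beta(X)+\beta z_2+\sqrt{2\log(2/\delta_2)}\,\sigma_2\beta,$$ $$\mathrm{RDP}^{\mathrm{upper}}(\alpha)=\mathrm{RDP}(\alpha,X)+SS_\beta(X)\,z_s+\sigma_s\sqrt{2\log(2/\delta_2)}\;e^{\mu}.$$ In the degenerate case $SS_\beta\equiv 0$, read $\log 0$ as $0$. 4. Convert at $\delta/2$: $\epsilon_{\sigma_1}=\mathrm{RDP}^{\mathrm{upper}}(\alpha)+\frac{\log(2/\delta)}{\alpha-1}$. If $\epsilon_{\sigma_1}\le\epsilon'$, return a student model trained on $(x_{1:T};y_{1:T})$; otherwise return $\perp$. **Theorem.** The algorithm satisfies $(\epsilon'+\hat\epsilon,\delta)$-DP,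 where $\mathrm{RDP}(\alpha,X)$ is the smallest data-dependent RDP function of the noisy labels and $SS_\beta$ is its $\beta$-smooth sensitivity. The same holds if $\mathrm{RDP}(\alpha,\cdot)$ is replaced by any data-dependent RDP function of order $\alpha$ for the noisy labels, and $SS_\beta$ by any $\beta$-smooth sensitivity bound of that function. In both cases the guarantee holds for the returned value (a student model or $\perp$), and also for the joint release of $\mu$, $\mathrm{RDP}^{\mathrm{upper}}(\alpha)$ and the returned value. -/

import Mathlib

open MeasureTheory ProbabilityTheory
open scoped ENNReal NNReal

/-! ### Datasets, randomized algorithms, privacy notions -/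

open Classical in
/-- Number of coordinates in which two datasets of the same size `n` differ. -/
noncomputable def recordDist {Z : Type*} {n : ℕ} (X Y : Fin n → Z) : ℕ :=
  hammingDist X Y

/-- Neighbouring datasets: they differ in at most one record. -/
def Neighbor {Z : Type*} {n : ℕ} (X Y : Fin n → Z) : Prop :=
  recordDist X Y ≤ 1

/-- A randomized algorithm is given by its output laws `M X`, one for each dataset `X`.
It is `(ε, δ)`-differentially private if for all neighbouring `X ≃ X'` and measurable `S`,
`Pr[M X ∈ S] ≤ e^ε Pr[M X' ∈ S] + δ`. -/
def IsDP {Z S : Type*} [MeasurableSpace S] {n : ℕ}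
    (M : (Fin n → Z) → Measure S) (ε δ : ℝ) : Prop :=
  ∀ X X' : Fin n → Z, Neighbor X X' → ∀ A : Set S, MeasurableSet A →
    M X A ≤ ENNReal.ofReal (Real.exp ε) * M X' A + ENNReal.ofReal δ

/-- The Rényi divergence of order `α > 1`,
`D_α(P ‖ Q) = (α - 1)⁻¹ log E_{o ∼ Q} [(dP/dQ)(o) ^ α]`, and `⊤` unless `P ≪ Q`. -/
noncomputable def renyiDiv {S : Type*} [MeasurableSpace S] (α : ℝ) (P Q : Measure S) : EReal :=
  open Classical in
  if P ≪ Q then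
    (((α - 1)⁻¹ : ℝ) : EReal) * ENNReal.log (∫⁻ o, (P.rnDeriv Q o) ^ α ∂Q)
  else ⊤

/-- `rdp` is a data-dependent RDP function of order `α` for `M`: for every dataset `X`, the
algorithm `M` is `(α, rdp X)`-RDP for the dataset `X`. -/
def IsDataDependentRDP {Z S : Type*} [MeasurableSpace S] {n : ℕ}
    (M : (Fin n → Z) → Measure S) (α : ℝ) (rdp : (Fin n → Z) → ℝ) : Prop :=
  ∀ X X' : Fin n → Z, Neighbor X X' → renyiDiv α (M X) (M X') ≤ (rdp X : EReal)

/-- The smallest data-dependent RDP function: the largest Rényi divergence of order `α` of `M X`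
from `M X'`, over all neighbours `X'` of `X`. -/
noncomputable def optimalRDP {Z S : Type*} [MeasurableSpace S] {n : ℕ}
    (M : (Fin n → Z) → Measure S) (α : ℝ) (X : Fin n → Z) : ℝ :=
  (⨆ (X' : Fin n → Z) (_ : Neighbor X X'), renyiDiv α (M X) (M X')).toReal

/-! ### Smooth sensitivity -/

/-- Local sensitivity of a real-valued function on datasets. -/
noncomputable def localSensitivity {Z : Type*} {n : ℕ} (f : (Fin n → Z) → ℝ)
    (X : Fin n → Z) : ℝ≥0∞ :=
  ⨆ (X' : Fin n → Z) (_ : Neighbor X X'), ENNReal.ofReal |f X - f X'|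

/-- The `β`-smooth sensitivity `max_{d ≥ 0} e^{-β d} max_{Y : dist(X, Y) ≤ d} Δ_LS(Y)`. -/
noncomputable def smoothSensitivity {Z : Type*} {n : ℕ} (β : ℝ) (f : (Fin n → Z) → ℝ)
    (X : Fin n → Z) : ℝ≥0∞ :=
  ⨆ d : ℕ, ENNReal.ofReal (Real.exp (-(β * d))) *
    ⨆ (Y : Fin n → Z) (_ : recordDist X Y ≤ d), localSensitivity f Y

/-- `SS` is a `β`-smooth sensitivity bound of `f`: it bounds the local sensitivity of `f`, and it
changes by a factor of at most `e^β` between neighbouring datasets. -/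
def IsSmoothSensitivityBound {Z : Type*} {n : ℕ} (β : ℝ) (f SS : (Fin n → Z) → ℝ) : Prop :=
  (∀ X X' : Fin n → Z, Neighbor X X' → |f X - f X'| ≤ SS X) ∧
  ∀ X X' : Fin n → Z, Neighbor X X' → SS X ≤ Real.exp β * SS X'

/-! ### The PATE set-up and its noisy labels -/

/-- The PATE set-up. The `n` private records are split into `K` disjoint shards; teacher `k` is a
classifier into `C` classes, trained on the records of shard `k` only. There are `T` unlabeled
public points, and a (possibly randomized) training procedure for the student model, with values in
the model space `Θ`, which only sees the public points and their labels. -/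
structure PATE (Z U Θ : Type*) [MeasurableSpace Θ] (n K T C : ℕ) where
  /-- the shard to which a record belongs -/
  shard : Fin n → Fin K
  /-- training of teacher `k` on its shard -/
  teacher : (k : Fin K) → ({i : Fin n // shard i = k} → Z) → U → Fin C
  /-- the unlabeled public data -/
  query : Fin T → U
  /-- law of the student model trained on labeled public data -/
  student : (Fin T → U × Fin C) → ProbabilityMeasure Θ

/-- Plurality label; ties are broken in favour of the smallest label. -/
noncomputable def argmaxLabel {C : ℕ} [NeZero C] (v : Fin C → ℝ) : Fin C :=
  (Finset.univ.filter fun j => ∀ k, v k ≤ v j).min' <| by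
    obtain ⟨j, hj⟩ := Finite.exists_max v
    exact ⟨j, by simpa using hj⟩

/-- The centred normal law `N(0, σ²)`. -/
noncomputable abbrev normalNoise (σ : ℝ) : Measure ℝ :=
  gaussianReal 0 (Real.toNNReal (σ ^ 2))

namespace PATE

variable {Z U Θ : Type*} [MeasurableSpace Θ] {n K T C : ℕ}

/-- The vote count `n_j(x)`: the number of teachers that predict label `j` at the point `x`. -/
def votes (P : PATE Z U Θ n K T C) (X : Fin n → Z) (x : U) (j : Fin C) : ℕ :=
  (Finset.univ.filter fun k : Fin K => P.teacher k (fun i => X i) x = j).card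

/-- Law of the noisy labels `y_i = argmax_j (n_j(x_i) + N(0, σ₁²))`, `i = 1, …, T`, with
independent noise for every query `i` and every label `j`. -/
noncomputable def noisyLabels [NeZero C] (P : PATE Z U Θ n K T C) (σ₁ : ℝ) (X : Fin n → Z) :
    Measure (Fin T → Fin C) :=
  (Measure.pi fun _ : Fin T => Measure.pi fun _ : Fin C => normalNoise σ₁).map
    fun g i => argmaxLabel fun j => (P.votes X (P.query i) j : ℝ) + g i j

/-- Law of the student model trained on the noisily labeled public data. -/
noncomputable def studentModel [NeZero C] (P : PATE Z U Θ n K T C) (σ₁ : ℝ) (X : Fin n → Z) :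
    Measure Θ :=
  (P.noisyLabels σ₁ X).bind fun y => (P.student fun i => (P.query i, y i) : Measure Θ)

end PATE

/-! ### Parameters of the algorithm and its private test -/

/-- The RDP order `α = 2 log(2/δ) / ε̂ + 1`. -/
noncomputable def ptrOrder (εhat δ : ℝ) : ℝ := 2 * Real.log (2 / δ) / εhat + 1

/-- The noise level `σ_s = σ₂ = √((3α + 2) / ε̂)`. -/
noncomputable def ptrSigma (εhat δ : ℝ) : ℝ := √((3 * ptrOrder εhat δ + 2) / εhat)

/-- The smoothness parameter `β = 0.2 / α`. -/
noncomputable def ptrBeta (εhat δ : ℝ) : ℝ := (1 / 5) / ptrOrder εhat δ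

/-- `μ = log SS + β z₂ + √(2 log(2/δ₂)) σ₂ β` with `δ₂ = δ/2`, where `z₂` is a sample of
`N(0, σ₂²)` and `ss` is the value of the smooth sensitivity. -/
noncomputable def ptrMu (εhat δ ss z₂ : ℝ) : ℝ :=
  Real.log ss + ptrBeta εhat δ * z₂
    + √(2 * Real.log (2 / (δ / 2))) * ptrSigma εhat δ * ptrBeta εhat δ

/-- `RDP^upper = RDP(α, X) + SS z_s + σ_s √(2 log(2/δ₂)) e^μ` with `δ₂ = δ/2`, where `z_s` is a
sample of `N(0, σ_s²)`, and `r`, `ss` are the values of the RDP function and of the smooth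
sensitivity. -/
noncomputable def ptrUpper (εhat δ r ss z₂ zs : ℝ) : ℝ :=
  r + ss * zs
    + ptrSigma εhat δ * √(2 * Real.log (2 / (δ / 2))) * Real.exp (ptrMu εhat δ ss z₂)

/-- Conversion of an `(α, r)`-RDP guarantee into an `(ε, δ₀)`-DP guarantee:
`ε = r + log(1/δ₀) / (α - 1)`. -/
noncomputable def rdpToDP (α δ₀ r : ℝ) : ℝ := r + Real.log (1 / δ₀) / (α - 1)

/-- Joint law of the two privately released numbers `(μ, RDP^upper)`; the noises `z₂ ∼ N(0, σ₂²)`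
and `z_s ∼ N(0, σ_s²)` are independent. -/
noncomputable def ptrTest (εhat δ r ss : ℝ) : Measure (ℝ × ℝ) :=
  ((normalNoise (ptrSigma εhat δ)).prod (normalNoise (ptrSigma εhat δ))).map
    fun z => (ptrMu εhat δ ss z.1, ptrUpper εhat δ r ss z.1 z.2)

open Classical in
/-- Given the two released numbers and the student model, what the algorithm releases in total:
`μ`, `RDP^upper`, and the returned value, which is the model (`Sum.inl`) if the DP guarantee that
`RDP^upper` converts to at `δ/2` is at most `ε'`, and `⊥` (`Sum.inr ()`) otherwise. -/
noncomputable def ptrRelease {Θ : Type*} (ε' εhat δ : ℝ) (w : (ℝ × ℝ) × Θ) :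
    ℝ × ℝ × (Θ ⊕ Unit) :=
  (w.1.1, w.1.2,
    if rdpToDP (ptrOrder εhat δ) (δ / 2) w.1.2 ≤ ε' then Sum.inl w.2 else Sum.inr ())

namespace PATE

variable {Z U Θ : Type*} [MeasurableSpace Θ] {n K T C : ℕ}

/-- PATE with generalized PTR, run with the data-dependent RDP function `rdp` and the smooth
sensitivity `SS`: law of everything that is released, namely `μ`, `RDP^upper` and the returned
value. The noises of the test are independent of the noisy labels and of the training of the
student. -/
noncomputable def ptrTranscript [NeZero C] (P : PATE Z U Θ n K T C) (σ₁ ε' εhat δ : ℝ)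
    (rdp SS : (Fin n → Z) → ℝ) (X : Fin n → Z) : Measure (ℝ × ℝ × (Θ ⊕ Unit)) :=
  ((ptrTest εhat δ (rdp X) (SS X)).prod (P.studentModel σ₁ X)).map (ptrRelease ε' εhat δ)

/-- PATE with generalized PTR: law of the returned value, a student model or `⊥`. -/
noncomputable def ptr [NeZero C] (P : PATE Z U Θ n K T C) (σ₁ ε' εhat δ : ℝ)
    (rdp SS : (Fin n → Z) → ℝ) (X : Fin n → Z) : Measure (Θ ⊕ Unit) :=
  (P.ptrTranscript σ₁ ε' εhat δ rdp SS X).map fun w => w.2.2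

/-- The data-dependent RDP, at the order `α` of the algorithm, of releasing all noisy labels. -/
noncomputable def labelRDP [NeZero C] (P : PATE Z U Θ n K T C) (σ₁ εhat δ : ℝ)
    (X : Fin n → Z) : ℝ :=
  optimalRDP (P.noisyLabels σ₁) (ptrOrder εhat δ) X

/-- The `β`-smooth sensitivity of the data-dependent RDP of the noisy labels. -/
noncomputable def labelSS [NeZero C] (P : PATE Z U Θ n K T C) (σ₁ εhat δ : ℝ)
    (X : Fin n → Z) : ℝ :=
  (smoothSensitivity (ptrBeta εhat δ) (P.labelRDP σ₁ εhat δ) X).toReal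

end PATE

/-! ### The laws above are probability measures -/

theorem measurable_argmaxLabel {C : ℕ} [NeZero C] :
    Measurable (argmaxLabel : (Fin C → ℝ) → Fin C) := by
  have key : ∀ (v : Fin C → ℝ) (j : Fin C), argmaxLabel v = j ↔
      (∀ k, v k ≤ v j) ∧ ∀ i, (∀ k, v k ≤ v i) → j ≤ i := by
    intro v j
    unfold argmaxLabel
    rw [Finset.min'_eq_iff]
    simp
  refine measurable_to_countable' fun j => ?_
  have : argmaxLabel ⁻¹' {j} = {v : Fin C → ℝ |
      (∀ k, v k ≤ v j) ∧ ∀ i, (∀ k, v k ≤ v i) → j ≤ i} := by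
    ext v; simp [key]
  rw [this]
  measurability

theorem measurable_ptrRelease {Θ : Type*} [MeasurableSpace Θ] (ε' εhat δ : ℝ) :
    Measurable (ptrRelease (Θ := Θ) ε' εhat δ) := by
  unfold ptrRelease rdpToDP
  refine Measurable.prodMk (by fun_prop) (Measurable.prodMk (by fun_prop) ?_)
  refine Measurable.ite (measurableSet_le (by fun_prop) (by fun_prop)) ?_ measurable_const
  exact measurable_inl.comp measurable_snd

namespace PATE

variable {Z U Θ : Type*} [MeasurableSpace Θ] {n K T C : ℕ}

instance [NeZero C] (P : PATE Z U Θ n K T C) (σ₁ : ℝ) (X : Fin n → Z) :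
    IsProbabilityMeasure (P.noisyLabels σ₁ X) := by
  refine Measure.isProbabilityMeasure_map (Measurable.aemeasurable ?_)
  refine measurable_pi_lambda _ fun i => measurable_argmaxLabel.comp ?_
  fun_prop

instance [NeZero C] (P : PATE Z U Θ n K T C) (σ₁ : ℝ) (X : Fin n → Z) :
    IsProbabilityMeasure (P.studentModel σ₁ X) := by
  refine isProbabilityMeasure_bind (Measurable.of_discrete.aemeasurable) ?_
  exact Filter.Eventually.of_forall fun y => inferInstance

instance [NeZero C] (P : PATE Z U Θ n K T C) (σ₁ ε' εhat δ : ℝ)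
    (rdp SS : (Fin n → Z) → ℝ) (X : Fin n → Z) :
    IsProbabilityMeasure (P.ptrTranscript σ₁ ε' εhat δ rdp SS X) := by
  have : IsProbabilityMeasure (ptrTest εhat δ (rdp X) (SS X)) := by
    refine Measure.isProbabilityMeasure_map (Measurable.aemeasurable ?_)
    unfold ptrUpper ptrMu
    fun_prop
  exact Measure.isProbabilityMeasure_map (measurable_ptrRelease _ _ _).aemeasurable

instance [NeZero C] (P : PATE Z U Θ n K T C) (σ₁ ε' εhat δ : ℝ)
    (rdp SS : (Fin n → Z) → ℝ) (X : Fin n → Z) :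
    IsProbabilityMeasure (P.ptr σ₁ ε' εhat δ rdp SS X) :=
  Measure.isProbabilityMeasure_map (by fun_prop)

end PATE

/-!
Releasing the labels together with the test `(μ, RDP^upper)` is a single Rényi-private mechanism.
After the change of variables `RDP^upper ↦ RDP^upper - c e^μ` the test is a pair of independent
normal variables. Smoothness of `SS` keeps `log SS` within `β` between neighbours, and it lets the
variance `SS² σ_s²` of the second variable change by a factor close to `1`, so the test costs
`α / (2σ₂²) + (α + 1) / σ_s² = ε̂ / 2` at order `α`.

If `RDP(α, X) + ε̂ / 2 ≤ ε'`, composing the test with the labels and converting the Rényi bound to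
approximate differential privacy gives the claim. Otherwise the student is released only if
`RDP^upper < RDP(α, X)`. This needs one of the two noises to fall below `-σ √(2 log(2/δ₂))`, hence
has probability at most `δ / 2`; apart from that event only the test is released.
-/

/-! ### Indistinguishable laws -/

/-- The two laws assign `(ε, δ)`-close probabilities to every event, in the direction from `P` to
`Q`: a mechanism is `(ε, δ)`-DP if its laws on any two neighbouring datasets are so related. -/
def Indistinguishable {S : Type*} [MeasurableSpace S] (ε : ℝ) (δ : ℝ≥0∞) (P Q : Measure S) :
    Prop :=
  ∀ A, MeasurableSet A → P A ≤ ENNReal.ofReal (Real.exp ε) * Q A + δ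

namespace Indistinguishable

variable {S S' Y : Type*} [MeasurableSpace S] [MeasurableSpace S'] [MeasurableSpace Y]
  {ε ε' : ℝ} {δ δ' : ℝ≥0∞} {P Q : Measure S}

theorem mono (h : Indistinguishable ε δ P Q) (hε : ε ≤ ε') (hδ : δ ≤ δ') :
    Indistinguishable ε' δ' P Q := fun A hA =>
  (h A hA).trans (by gcongr)

theorem map (h : Indistinguishable ε δ P Q) {φ : S → S'} (hφ : Measurable φ) :
    Indistinguishable ε δ (P.map φ) (Q.map φ) := fun A hA => by
  rw [Measure.map_apply hφ hA, Measure.map_apply hφ hA]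
  exact h _ (hφ hA)

theorem lintegral_le (h : Indistinguishable ε δ P Q) {f : S → ℝ} (hf : Measurable f)
    (hf0 : ∀ x, 0 ≤ f x) (hf1 : ∀ x, f x ≤ 1) :
    ∫⁻ x, ENNReal.ofReal (f x) ∂P
      ≤ ENNReal.ofReal (Real.exp ε) * ∫⁻ x, ENNReal.ofReal (f x) ∂Q + δ := by
  have level (t : ℝ) (_ : t ∈ Set.Ioi 0) : P {x | t < f x} ≤
      ENNReal.ofReal (Real.exp ε) * Q {x | t < f x} + (Set.Iio 1).indicator (fun _ => δ) t := by
    by_cases ht1 : t < 1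
    · simpa [ht1] using h _ (measurableSet_lt measurable_const hf)
    · simp [Set.eq_empty_of_forall_notMem (s := {x | t < f x}) fun x hx =>
        ht1 (lt_of_lt_of_le hx (hf1 x))]
  have hδ : ∫⁻ t in Set.Ioi (0 : ℝ), (Set.Iio 1).indicator (fun _ => δ) t = δ := by
    simp [lintegral_indicator, Measure.restrict_restrict, Set.Iio_inter_Ioi]
  rw [lintegral_eq_lintegral_meas_lt P (ae_of_all _ hf0) hf.aemeasurable,
    lintegral_eq_lintegral_meas_lt Q (ae_of_all _ hf0) hf.aemeasurable,
    ← lintegral_const_mul' _ _ ENNReal.ofReal_ne_top]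
  calc _ ≤ _ := setLIntegral_mono' measurableSet_Ioi level
    _ = _ := by rw [lintegral_add_right _ (measurable_const.indicator measurableSet_Iio), hδ]

theorem bind (h : Indistinguishable ε δ P Q) (κ : Kernel S S') [IsMarkovKernel κ] :
    Indistinguishable ε δ (P.bind κ) (Q.bind κ) := fun A hA => by
  have hκ := h.lintegral_le (f := fun x => (κ x).real A) (κ.measurable_coe hA).ennreal_toReal
    (fun _ => measureReal_nonneg) (fun _ => measureReal_le_one)
  have hκA x : ENNReal.ofReal ((κ x).real A) = κ x A := ofReal_measureReal
  simpa only [Measure.bind_apply hA κ.aemeasurable, hκA] using hκ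

/-- The event `G` on which the second component may influence the outcome is charged entirely to
the failure probability. -/
theorem map_prod_of_determined {W : Type*} [MeasurableSpace W] {τ τ' : Measure W}
    (h : Indistinguishable ε δ τ τ') (P P' : Measure Y) [IsProbabilityMeasure P]
    [IsProbabilityMeasure P'] {φ : W × Y → S} {ψ : W → S} (hφ : Measurable φ) (hψ : Measurable ψ)
    {G : Set W} (hG : MeasurableSet G) (hφψ : ∀ w ∉ G, ∀ y, φ (w, y) = ψ w) (hτG : τ G ≤ δ') :
    Indistinguishable ε (δ + δ') ((τ.prod P).map φ) ((τ'.prod P').map φ) := fun A hA => by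
  set F := Gᶜ ∩ ψ ⁻¹' A
  have outer : φ ⁻¹' A ⊆ (F ∪ G) ×ˢ Set.univ := fun ⟨w, y⟩ hw => by
    by_cases hwG : w ∈ G
    · exact ⟨.inr hwG, trivial⟩
    · exact ⟨.inl ⟨hwG, by simpa [← hφψ w hwG y] using hw⟩, trivial⟩
  have inner : F ×ˢ Set.univ ⊆ φ ⁻¹' A := fun ⟨w, y⟩ ⟨⟨hwG, hw⟩, _⟩ => by
    simpa [hφψ w hwG y] using hw
  rw [Measure.map_apply hφ hA, Measure.map_apply hφ hA]
  calc τ.prod P (φ ⁻¹' A) ≤ τ.prod P ((F ∪ G) ×ˢ Set.univ) := measure_mono outer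
    _ = τ (F ∪ G) := by rw [Measure.prod_prod, measure_univ, mul_one]
    _ ≤ τ F + τ G := measure_union_le _ _
    _ ≤ ENNReal.ofReal (Real.exp ε) * τ' F + δ + δ' :=
        add_le_add (h F (hG.compl.inter (hψ hA))) hτG
    _ ≤ ENNReal.ofReal (Real.exp ε) * τ'.prod P' (φ ⁻¹' A) + (δ + δ') := by
        rw [add_assoc]
        gcongr
        simpa using measure_mono (μ := τ'.prod P') inner

end Indistinguishable

/-! ### Rényi bounds -/

/-- `P` has a density with respect to `Q` whose `α`-th moment is at most `exp ((α - 1) * b)`: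
the density form of "the Rényi divergence of order `α` of `P` from `Q` is at most `b`". It avoids
the extended-real arithmetic and the junk values of `renyiDiv` at `⊤`. -/
def RenyiBound {S : Type*} [MeasurableSpace S] (α : ℝ) (P Q : Measure S) (b : ℝ) : Prop :=
  ∃ g : S → ℝ≥0∞, Measurable g ∧ P = Q.withDensity g ∧
    ∫⁻ x, g x ^ α ∂Q ≤ ENNReal.ofReal (Real.exp ((α - 1) * b))

theorem le_add_rpow_mul_rpow {κ : ℝ≥0∞} (hκ0 : κ ≠ 0) (hκt : κ ≠ ∞) {α : ℝ} (hα : 1 ≤ α)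
    (x : ℝ≥0∞) : x ≤ κ + κ ^ (1 - α) * x ^ α := by
  rcases le_total x κ with hx | hx
  · exact hx.trans le_self_add
  · refine le_add_left ?_
    calc x = κ ^ (1 - α) * (κ ^ (α - 1) * x ^ (1 : ℝ)) := by
          rw [← mul_assoc, ← ENNReal.rpow_add _ _ hκ0 hκt]
          simp
      _ ≤ κ ^ (1 - α) * (x ^ (α - 1) * x ^ (1 : ℝ)) := by gcongr
      _ = κ ^ (1 - α) * x ^ α := by
          rw [← ENNReal.rpow_add_of_nonneg _ _ (by linarith) zero_le_one, sub_add_cancel]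

namespace RenyiBound

variable {S S' : Type*} [MeasurableSpace S] [MeasurableSpace S'] {α b b' : ℝ}

theorem refl (Q : Measure S) [IsProbabilityMeasure Q] : RenyiBound α Q Q 0 :=
  ⟨fun _ => 1, measurable_const, by simp, by simp⟩

theorem mono {P Q : Measure S} (hα : 1 ≤ α) (h : RenyiBound α P Q b) (hb : b ≤ b') :
    RenyiBound α P Q b' := by
  obtain ⟨g, hg, hP, hI⟩ := h
  refine ⟨g, hg, hP, hI.trans (ENNReal.ofReal_le_ofReal (Real.exp_le_exp.2 ?_))⟩
  exact mul_le_mul_of_nonneg_left hb (sub_nonneg.2 hα)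

theorem prod {P Q : Measure S} {P' Q' : Measure S'} [SFinite Q'] (hα : 0 ≤ α)
    (h : RenyiBound α P Q b) (h' : RenyiBound α P' Q' b') :
    RenyiBound α (P.prod P') (Q.prod Q') (b + b') := by
  obtain ⟨g, hg, hP, hI⟩ := h
  obtain ⟨g', hg', hP', hI'⟩ := h'
  refine ⟨fun z => g z.1 * g' z.2, by fun_prop, by rw [hP, hP', prod_withDensity hg hg'], ?_⟩
  simp_rw [ENNReal.mul_rpow_of_nonneg _ _ hα]
  rw [lintegral_prod_mul (hg.pow_const α).aemeasurable (hg'.pow_const α).aemeasurable, mul_add,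
    Real.exp_add, ENNReal.ofReal_mul (Real.exp_nonneg _)]
  exact mul_le_mul' hI hI'

theorem map {P Q : Measure S} (h : RenyiBound α P Q b) {φ : S → S'} {ψ : S' → S}
    (hφ : Measurable φ) (hψ : Measurable ψ) (hψφ : Function.LeftInverse ψ φ) :
    RenyiBound α (P.map φ) (Q.map φ) b := by
  obtain ⟨g, hg, hP, hI⟩ := h
  refine ⟨g ∘ ψ, hg.comp hψ, ?_, ?_⟩
  · ext A hA
    rw [Measure.map_apply hφ hA, withDensity_apply _ hA, hP, withDensity_apply _ (hφ hA),
      setLIntegral_map hA (hg.comp hψ) hφ]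
    simp only [Function.comp_apply, hψφ _]
  · rw [lintegral_map (by fun_prop) hφ]
    simpa only [Function.comp_apply, hψφ _] using hI

theorem of_withDensity {ν : Measure S} {p q : S → ℝ≥0∞} (hp : Measurable p) (hq : Measurable q)
    (hq0 : ∀ x, q x ≠ 0) (hqt : ∀ x, q x ≠ ∞) (hα : 0 ≤ α)
    (h : ∫⁻ x, p x ^ α * q x ^ (1 - α) ∂ν ≤ ENNReal.ofReal (Real.exp ((α - 1) * b))) :
    RenyiBound α (ν.withDensity p) (ν.withDensity q) b := by
  refine ⟨p / q, hp.div hq, ?_, ?_⟩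
  · rw [← withDensity_mul _ hq (hp.div hq)]
    congr 1
    funext x
    exact (ENNReal.mul_div_cancel (hq0 x) (hqt x)).symm
  · rw [lintegral_withDensity_eq_lintegral_mul _ hq ((hp.div hq).pow_const α)]
    refine (lintegral_congr fun x => ?_).trans_le h
    simp only [Pi.mul_apply, Pi.div_apply]
    rw [ENNReal.div_rpow_of_nonneg _ _ hα, ENNReal.rpow_sub _ _ (hq0 x) (hqt x),
      ENNReal.rpow_one, ENNReal.div_eq_inv_mul, ENNReal.div_eq_inv_mul]
    ring

theorem of_renyiDiv_le {P Q : Measure S} [SigmaFinite P] [SigmaFinite Q] (hα : 1 < α)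
    (h : renyiDiv α P Q ≤ (b : EReal)) : RenyiBound α P Q b := by
  unfold renyiDiv at h
  split_ifs at h with hPQ
  · refine ⟨P.rnDeriv Q, Measure.measurable_rnDeriv _ _,
      (Measure.withDensity_rnDeriv_eq P Q hPQ).symm, ?_⟩
    have hα' : (0 : EReal) < ((α - 1 : ℝ) : EReal) := EReal.coe_pos.2 (sub_pos.2 hα)
    rwa [EReal.coe_inv, ← EReal.div_eq_inv_mul, EReal.div_le_iff_le_mul hα' (EReal.coe_ne_top _),
      ← EReal.coe_mul, ← Real.log_exp ((α - 1) * b), ← ENNReal.log_ofReal_of_pos (Real.exp_pos _),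
      ENNReal.log_le_log_iff] at h
  · exact absurd h (not_le.2 (EReal.coe_lt_top b))

theorem indistinguishable {P Q : Measure S} (hα : 1 ≤ α) (h : RenyiBound α P Q b) (ε : ℝ) :
    Indistinguishable ε (ENNReal.ofReal (Real.exp ((α - 1) * (b - ε)))) P Q := fun A hA => by
  obtain ⟨g, hg, rfl, hI⟩ := h
  set κ := ENNReal.ofReal (Real.exp ε) with hκ
  have hκ0 : κ ≠ 0 := by simpa [κ] using Real.exp_pos ε
  have hκα : κ ^ (1 - α) = ENNReal.ofReal (Real.exp (-((α - 1) * ε))) := by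
    rw [hκ, ENNReal.ofReal_rpow_of_pos (Real.exp_pos _), ← Real.exp_mul]
    ring_nf
  rw [withDensity_apply _ hA]
  calc ∫⁻ x in A, g x ∂Q ≤ ∫⁻ x in A, (κ + κ ^ (1 - α) * g x ^ α) ∂Q :=
        lintegral_mono fun x => le_add_rpow_mul_rpow hκ0 ENNReal.ofReal_ne_top hα (g x)
    _ = κ * Q A + κ ^ (1 - α) * ∫⁻ x in A, g x ^ α ∂Q := by
        rw [lintegral_add_left measurable_const, setLIntegral_const,
          lintegral_const_mul _ (hg.pow_const α)]
    _ ≤ κ * Q A + κ ^ (1 - α) * ENNReal.ofReal (Real.exp ((α - 1) * b)) := by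
        gcongr
        exact (setLIntegral_le_lintegral A _).trans hI
    _ = κ * Q A + ENNReal.ofReal (Real.exp ((α - 1) * (b - ε))) := by
        rw [hκα, ← ENNReal.ofReal_mul (Real.exp_nonneg _), ← Real.exp_add]
        ring_nf

end RenyiBound

/-! ### Normal laws -/

theorem normalNoise_Iic_le {σ t : ℝ} (hσ : 0 < σ) (ht : 0 ≤ t) :
    normalNoise σ (Set.Iic (-(t * σ))) ≤ ENNReal.ofReal (Real.exp (-t ^ 2 / 2)) := by
  have chernoff := measure_le_le_exp_mul_mgf (μ := normalNoise σ) (X := id)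
    (t := -(t / σ)) (-(t * σ)) (neg_nonpos.2 (by positivity)) (integrable_exp_mul_gaussianReal _)
  rw [mgf_id_gaussianReal, ← Real.exp_add, Real.coe_toNNReal _ (sq_nonneg σ)] at chernoff
  rw [← ofReal_measureReal]
  refine ENNReal.ofReal_le_ofReal (chernoff.trans_eq ?_)
  congr 1
  field_simp
  ring

theorem normalNoise_Iic_sqrt_log_le {σ x : ℝ} (hσ : 0 < σ) (hx : 1 ≤ x) :
    normalNoise σ (Set.Iic (-(√(2 * Real.log x) * σ))) ≤ ENNReal.ofReal x⁻¹ := by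
  have hlog : 0 ≤ Real.log x := Real.log_nonneg hx
  refine (normalNoise_Iic_le hσ (Real.sqrt_nonneg _)).trans_eq ?_
  rw [Real.sq_sqrt (by positivity), neg_div, mul_div_cancel_left₀ _ two_ne_zero, Real.exp_neg,
    Real.exp_log (zero_lt_one.trans_le hx)]

theorem map_affine_normalNoise (σ c d : ℝ) :
    (normalNoise σ).map (fun z => c * z + d) = gaussianReal d (Real.toNNReal ((c * σ) ^ 2)) := by
  calc (normalNoise σ).map (fun z => c * z + d)
      = ((normalNoise σ).map fun z => c * z).map fun z => z + d :=
        (Measure.map_map (measurable_add_const d) (measurable_const_mul c)).symm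
    _ = gaussianReal d (Real.toNNReal ((c * σ) ^ 2)) := by
        rw [gaussianReal_map_const_mul, gaussianReal_map_add_const, mul_zero, zero_add, mul_pow,
          Real.toNNReal_mul (sq_nonneg c), Real.toNNReal_of_nonneg (sq_nonneg c)]

/-- Closed form of the Rényi divergence of order `α` of `N(m, v)` from `N(m', w)`; it is only
meaningful for `1 < α` and `0 < α * w - (α - 1) * v` (beyond that range the divergence is `⊤`). -/
noncomputable def gaussianRenyi (α m m' v w : ℝ) : ℝ :=
  Real.log (w / v) / 2 + Real.log (w / (α * w - (α - 1) * v)) / (2 * (α - 1))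
    + α * (m - m') ^ 2 / (2 * (α * w - (α - 1) * v))

theorem gaussianPDFReal_eq_exp (m : ℝ) {v : ℝ≥0} (hv : 0 < v) (x : ℝ) :
    gaussianPDFReal m v x =
      Real.exp (-(Real.log (2 * Real.pi) + Real.log v) / 2 - (x - m) ^ 2 / (2 * v)) := by
  have hv' : (0 : ℝ) < v := hv
  rw [gaussianPDFReal_def, sub_eq_add_neg, Real.exp_add, neg_div, Real.exp_neg,
    ← Real.log_mul (by positivity) hv'.ne', ← Real.log_sqrt (by positivity),
    Real.exp_log (by positivity), ← neg_div]

/-- Completing the square: up to a constant, the `α`-geometric mean of two normal densities is a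
normal density. -/
theorem gaussianPDFReal_rpow_mul_rpow {α : ℝ} (hα : 1 < α) (m m' : ℝ) {v w : ℝ≥0} (hv : 0 < v)
    (hw : 0 < w) (hW : 0 < α * w - (α - 1) * v) (x : ℝ) :
    gaussianPDFReal m v x ^ α * gaussianPDFReal m' w x ^ (1 - α) =
      Real.exp ((α - 1) * gaussianRenyi α m m' v w) *
        gaussianPDFReal ((α * m * w - (α - 1) * m' * v) / (α * w - (α - 1) * v))
          (v * w / (α * w - (α - 1) * v)).toNNReal x := by
  have hv' : (0 : ℝ) < v := hv
  have hw' : (0 : ℝ) < w := hw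
  have hα' : 0 < α - 1 := sub_pos.2 hα
  unfold gaussianRenyi
  obtain ⟨W, hWdef⟩ : ∃ W : ℝ, W = α * w - (α - 1) * v := ⟨_, rfl⟩
  rw [← hWdef] at hW ⊢
  obtain ⟨c, hc⟩ : ∃ c : ℝ, c = (α * m * w - (α - 1) * m' * v) / W := ⟨_, rfl⟩
  have hu : 0 < v * w / W := by positivity
  have hlog : Real.log (v * w / W) = Real.log v + Real.log w - Real.log W := by
    rw [Real.log_div (by positivity) hW.ne', Real.log_mul hv'.ne' hw'.ne']
  have square : α * (α - 1) * (m - m') ^ 2 / (2 * W) - (x - c) ^ 2 / (2 * (v * w / W))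
      = (α - 1) * (x - m') ^ 2 / (2 * w) - α * (x - m) ^ 2 / (2 * v) := by
    rw [hc]
    field_simp
    rw [hWdef]
    ring
  rw [← hc, gaussianPDFReal_eq_exp m hv, gaussianPDFReal_eq_exp m' hw,
    gaussianPDFReal_eq_exp c (Real.toNNReal_pos.2 hu), Real.coe_toNNReal _ hu.le, hlog,
    Real.log_div hw'.ne' hv'.ne', Real.log_div hw'.ne' hW.ne', ← Real.exp_mul, ← Real.exp_mul,
    ← Real.exp_add, ← Real.exp_add]
  have hcancel (l : ℝ) : (α - 1) * (l / (2 * (α - 1))) = l / 2 := by field_simp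
  congr 1
  rw [mul_add, mul_add, hcancel]
  linear_combination -square

theorem renyiBound_gaussianReal {α : ℝ} (hα : 1 < α) (m m' : ℝ) {v w : ℝ≥0} (hv : 0 < v)
    (hw : 0 < w) (hW : 0 < α * w - (α - 1) * v) :
    RenyiBound α (gaussianReal m v) (gaussianReal m' w) (gaussianRenyi α m m' v w) := by
  have hu : 0 < v * w / (α * w - (α - 1) * v) :=
    div_pos (mul_pos (NNReal.coe_pos.2 hv) (NNReal.coe_pos.2 hw)) hW
  rw [gaussianReal_of_var_ne_zero m hv.ne', gaussianReal_of_var_ne_zero m' hw.ne']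
  refine .of_withDensity (measurable_gaussianPDF m v) (measurable_gaussianPDF m' w)
    (fun x => (gaussianPDF_pos m' hw.ne' x).ne') (fun x => ENNReal.ofReal_ne_top)
    (zero_le_one.trans hα.le) (le_of_eq ?_)
  calc ∫⁻ x, gaussianPDF m v x ^ α * gaussianPDF m' w x ^ (1 - α)
      = ∫⁻ x, ENNReal.ofReal (Real.exp ((α - 1) * gaussianRenyi α m m' v w)) *
          gaussianPDF ((α * m * w - (α - 1) * m' * v) / (α * w - (α - 1) * v))
            (v * w / (α * w - (α - 1) * v)).toNNReal x := by
        refine lintegral_congr fun x => ?_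
        simp only [gaussianPDF]
        rw [ENNReal.ofReal_rpow_of_pos (gaussianPDFReal_pos m v x hv.ne'),
          ENNReal.ofReal_rpow_of_pos (gaussianPDFReal_pos m' w x hw.ne'),
          ← ENNReal.ofReal_mul (Real.rpow_nonneg (gaussianPDFReal_nonneg m v x) α),
          gaussianPDFReal_rpow_mul_rpow hα m m' hv hw hW, ENNReal.ofReal_mul (Real.exp_nonneg _)]
    _ = ENNReal.ofReal (Real.exp ((α - 1) * gaussianRenyi α m m' v w)) := by
        rw [lintegral_const_mul _ (measurable_gaussianPDF _ _),
          lintegral_gaussianPDF_eq_one _ (Real.toNNReal_pos.2 hu).ne', mul_one]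

theorem renyiBound_gaussianReal_same_variance {α : ℝ} (hα : 1 < α) (m m' : ℝ) {v : ℝ≥0}
    (hv : 0 < v) :
    RenyiBound α (gaussianReal m v) (gaussianReal m' v) (α * (m - m') ^ 2 / (2 * v)) := by
  have hv' : (v : ℝ) ≠ 0 := (NNReal.coe_pos.2 hv).ne'
  have hW : α * v - (α - 1) * v = v := by ring
  have h := renyiBound_gaussianReal hα m m' hv hv (by rw [hW]; exact hv)
  simpa only [gaussianRenyi, hW, div_self hv', Real.log_one, zero_div, zero_add] using h

/-! ### Normal laws whose standard deviation is a smooth sensitivity -/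

theorem abs_exp_sub_one_le_div {u : ℝ} (hu : |u| < 1) : |Real.exp u - 1| ≤ |u| / (1 - |u|) := by
  have hu' : 0 < 1 - |u| := sub_pos.2 hu
  rw [abs_le]
  constructor
  · calc -(|u| / (1 - |u|)) ≤ -|u| :=
          neg_le_neg (le_div_self (abs_nonneg u) hu' (by linarith [abs_nonneg u]))
      _ ≤ Real.exp u - 1 := by linarith [neg_abs_le u, Real.add_one_le_exp u]
  · calc Real.exp u - 1 ≤ 1 / (1 - |u|) - 1 := by
          gcongr
          exact (Real.exp_le_exp.2 (le_abs_self u)).trans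
            (Real.exp_bound_div_one_sub_of_interval (abs_nonneg u) hu)
      _ = |u| / (1 - |u|) := by field_simp; ring

theorem abs_sub_one_mul_exp_sub_one_le {a c u : ℝ} (ha : 1 ≤ a) (hc : c < 1) (hu : a * |u| ≤ c) :
    |(a - 1) * (Real.exp u - 1)| ≤ c := by
  have hu1 : |u| < 1 := (le_mul_of_one_le_left (abs_nonneg u) ha).trans_lt (hu.trans_lt hc)
  rw [abs_mul, abs_of_nonneg (sub_nonneg.2 ha)]
  calc (a - 1) * |Real.exp u - 1| ≤ (a - 1) * (|u| / (1 - |u|)) :=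
        mul_le_mul_of_nonneg_left (abs_exp_sub_one_le_div hu1) (sub_nonneg.2 ha)
    _ ≤ c := by
        rw [← mul_div_assoc, div_le_iff₀ (sub_pos.2 hu1)]
        nlinarith [abs_nonneg u]

theorem sub_one_mul_exp_sub_one_sub_id_le {a c u : ℝ} (ha : 1 ≤ a) (hc : c ≤ 1)
    (hu : a * |u| ≤ c) : (a - 1) * (Real.exp u - 1 - u) ≤ c ^ 2 / a := by
  have ha0 : 0 < a := zero_lt_one.trans_le ha
  have hu1 : |u| ≤ 1 := (le_mul_of_one_le_left (abs_nonneg u) ha).trans (hu.trans hc)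
  rw [le_div_iff₀ ha0]
  calc (a - 1) * (Real.exp u - 1 - u) * a ≤ (a - 1) * u ^ 2 * a := by
        gcongr
        exact (le_abs_self _).trans (Real.abs_exp_sub_one_sub_id_le hu1)
    _ ≤ a * u ^ 2 * a := by gcongr; linarith
    _ = (a * |u|) ^ 2 := by rw [mul_pow, sq_abs]; ring
    _ ≤ c ^ 2 := by gcongr

theorem three_fifths_le_interpolated_variance {a u : ℝ} (ha : 1 ≤ a) (hu : a * |u| ≤ 2 / 5) :
    3 / 5 ≤ a - (a - 1) * Real.exp u := by
  linarith [(abs_le.1 (abs_sub_one_mul_exp_sub_one_le ha (by norm_num) hu)).2]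

theorem neg_log_one_sub_le {y : ℝ} (hy : |y| ≤ 2 / 5) : -Real.log (1 - y) ≤ y + 18 / 125 := by
  have taylor := Real.abs_log_sub_add_sum_range_le (x := y) (by linarith) 3
  have remainder : |y| ^ (3 + 1) / (1 - |y|) ≤ (2 / 5) ^ 4 / (3 / 5) := by
    gcongr
    linarith
  have hsq : y ^ 2 ≤ (2 / 5) ^ 2 := by
    rw [← sq_abs]
    gcongr
  have hcube : y ^ 3 ≤ (2 / 5) ^ 3 := (le_abs_self _).trans (by rw [abs_pow]; gcongr)
  have hlow := (abs_le.1 (taylor.trans remainder)).1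
  norm_num [Finset.sum_range_succ] at hlow hsq hcube
  linarith

/-- The left-hand side is what two variances with ratio `exp u` contribute to
`2 * (a - 1) * gaussianRenyi`. As `2 log 2 ≤ (α - 1) ε̂`, the right-hand side is at most
`(α - 1) (α / 3 + 2) / σ_s²` for the algorithm's `σ_s² = (3α + 2) / ε̂`. -/
theorem variance_mismatch_le {a u : ℝ} (ha : 1 ≤ a) (hu : a * |u| ≤ 2 / 5) :
    -((a - 1) * u) - Real.log (a - (a - 1) * Real.exp u)
      ≤ 2 * Real.log 2 * (a / 3 + 2) / (3 * a + 2) := by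
  have ha0 : 0 < a := zero_lt_one.trans_le ha
  have hlog := neg_log_one_sub_le (abs_sub_one_mul_exp_sub_one_le ha (by norm_num) hu)
  have hquad := sub_one_mul_exp_sub_one_sub_id_le ha (by norm_num) hu
  have hV : a - (a - 1) * Real.exp u = 1 - (a - 1) * (Real.exp u - 1) := by ring
  rw [hV]
  calc -((a - 1) * u) - Real.log (1 - (a - 1) * (Real.exp u - 1))
      ≤ (2 / 5) ^ 2 / a + 18 / 125 := by linarith
    _ ≤ 2 * (69 / 100) * (a / 3 + 2) / (3 * a + 2) := by
        have hdiv : (2 / 5) ^ 2 / a * a = (2 / 5) ^ 2 := div_mul_cancel₀ _ ha0.ne'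
        have hdiv1 : (2 / 5) ^ 2 / a ≤ (2 / 5) ^ 2 := div_le_self (by norm_num) ha
        rw [le_div_iff₀ (by positivity)]
        nlinarith
    _ ≤ 2 * Real.log 2 * (a / 3 + 2) / (3 * a + 2) := by
        gcongr
        linarith [Real.log_two_gt_d9]

theorem abs_log_sub_log_le {β s s' : ℝ} (hs : 0 < s) (hs' : 0 < s') (h : s ≤ Real.exp β * s')
    (h' : s' ≤ Real.exp β * s) : |Real.log s - Real.log s'| ≤ β := by
  have e := Real.log_le_log hs h
  have e' := Real.log_le_log hs' h'
  rw [Real.log_mul (Real.exp_ne_zero _) (by positivity), Real.log_exp] at e e'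
  exact abs_sub_le_iff.2 ⟨by linarith, by linarith⟩

theorem interpolated_variance_eq (α σ : ℝ) {s s' : ℝ} (hs : 0 < s) (hs' : 0 < s') :
    α * (s' * σ) ^ 2 - (α - 1) * (s * σ) ^ 2 =
      (α - (α - 1) * Real.exp (2 * (Real.log s - Real.log s'))) * (s' * σ) ^ 2 := by
  rw [← Real.log_div hs.ne' hs'.ne', mul_comm 2, Real.exp_mul, Real.exp_log (by positivity),
    Real.rpow_two]
  field_simp

theorem gaussianRenyi_mul_sq_le {α σ r r' s s' : ℝ} (hα : 1 < α) (hσ : 0 < σ) (hs : 0 < s)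
    (hs' : 0 < s') (hlog : α * |2 * (Real.log s - Real.log s')| ≤ 2 / 5) (hr : |r - r'| ≤ s')
    (hσα : 2 * Real.log 2 * σ ^ 2 ≤ (α - 1) * (3 * α + 2)) :
    gaussianRenyi α r r' ((s * σ) ^ 2) ((s' * σ) ^ 2) ≤ (α + 1) / σ ^ 2 := by
  have hα1 : 0 < α - 1 := sub_pos.2 hα
  have hV := three_fifths_le_interpolated_variance hα.le hlog
  have hmismatch := variance_mismatch_le hα.le hlog
  have hratio : Real.log ((s' * σ) ^ 2 / (s * σ) ^ 2) = -(2 * (Real.log s - Real.log s')) := by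
    rw [mul_pow, mul_pow, mul_div_mul_right _ _ (by positivity), ← div_pow, Real.log_pow,
      Real.log_div hs'.ne' hs.ne']
    push_cast
    ring
  have hr2 : (r - r') ^ 2 ≤ s' ^ 2 := sq_le_sq.2 (hr.trans (le_abs_self s'))
  rw [gaussianRenyi, interpolated_variance_eq α σ hs hs', hratio,
    div_mul_cancel_right₀ (by positivity), Real.log_inv]
  generalize 2 * (Real.log s - Real.log s') = u at *
  set V := α - (α - 1) * Real.exp u
  calc -u / 2 + -Real.log V / (2 * (α - 1)) + α * (r - r') ^ 2 / (2 * (V * (s' * σ) ^ 2))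
      = (-((α - 1) * u) - Real.log V) / (2 * (α - 1))
          + α * (r - r') ^ 2 / (2 * (V * (s' * σ) ^ 2)) := by field_simp; ring
    _ ≤ 2 * Real.log 2 * (α / 3 + 2) / (3 * α + 2) / (2 * (α - 1))
          + α * s' ^ 2 / (2 * (3 / 5 * (s' * σ) ^ 2)) := by gcongr
    _ ≤ (α / 6 + 1) / σ ^ 2 + 5 * α / 6 / σ ^ 2 := by
        refine add_le_add ?_ (by field_simp; norm_num)
        rw [div_div, div_le_div_iff₀ (by positivity) (by positivity)]
        nlinarith
    _ = (α + 1) / σ ^ 2 := by ring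

theorem renyiBound_gaussianReal_mul_sq {α σ r r' s s' : ℝ} (hα : 1 < α) (hσ : 0 < σ) (hs : 0 < s)
    (hs' : 0 < s') (hlog : α * |2 * (Real.log s - Real.log s')| ≤ 2 / 5) (hr : |r - r'| ≤ s')
    (hσα : 2 * Real.log 2 * σ ^ 2 ≤ (α - 1) * (3 * α + 2)) :
    RenyiBound α (gaussianReal r (Real.toNNReal ((s * σ) ^ 2)))
      (gaussianReal r' (Real.toNNReal ((s' * σ) ^ 2))) ((α + 1) / σ ^ 2) := by
  have hW : 0 < α * (s' * σ) ^ 2 - (α - 1) * (s * σ) ^ 2 := by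
    have hV := three_fifths_le_interpolated_variance hα.le hlog
    rw [interpolated_variance_eq α σ hs hs']
    exact mul_pos (by linarith) (by positivity)
  have coe (x : ℝ) : ((x ^ 2).toNNReal : ℝ) = x ^ 2 := Real.coe_toNNReal _ (sq_nonneg x)
  refine (renyiBound_gaussianReal hα r r' (Real.toNNReal_pos.2 (by positivity))
    (Real.toNNReal_pos.2 (by positivity)) ?_).mono hα.le ?_ <;> rw [coe, coe]
  · exact hW
  · exact gaussianRenyi_mul_sq_le hα hσ hs hs' hlog hr hσα

/-! ### The private test -/

theorem one_lt_ptrOrder {εhat δ : ℝ} (hεhat : 0 < εhat) (hδ : 0 < δ) (hδ2 : δ < 2) :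
    1 < ptrOrder εhat δ := by
  have hlog : 0 < Real.log (2 / δ) := Real.log_pos ((one_lt_div hδ).2 hδ2)
  exact lt_add_of_pos_left 1 (by positivity)

theorem ptrOrder_sub_one_mul {εhat : ℝ} (hεhat : εhat ≠ 0) (δ : ℝ) :
    (ptrOrder εhat δ - 1) * εhat = 2 * Real.log (2 / δ) := by
  rw [ptrOrder, add_sub_cancel_right, div_mul_cancel₀ _ hεhat]

theorem ptrSigma_pos {εhat δ : ℝ} (hεhat : 0 < εhat) (hα : 0 < ptrOrder εhat δ) :
    0 < ptrSigma εhat δ :=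
  Real.sqrt_pos.2 (by positivity)

theorem ptrSigma_sq {εhat δ : ℝ} (hεhat : 0 < εhat) (hα : 0 < ptrOrder εhat δ) :
    ptrSigma εhat δ ^ 2 = (3 * ptrOrder εhat δ + 2) / εhat :=
  Real.sq_sqrt (by positivity)

theorem two_mul_log_two_mul_ptrSigma_sq_le {εhat δ : ℝ} (hεhat : 0 < εhat) (hδ : 0 < δ)
    (hδ1 : δ ≤ 1) : 2 * Real.log 2 * ptrSigma εhat δ ^ 2
      ≤ (ptrOrder εhat δ - 1) * (3 * ptrOrder εhat δ + 2) := by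
  have hα := zero_lt_one.trans (one_lt_ptrOrder hεhat hδ (hδ1.trans_lt one_lt_two))
  have hlog : Real.log 2 ≤ Real.log (2 / δ) :=
    Real.log_le_log zero_lt_two (le_div_self zero_le_two hδ hδ1)
  rw [ptrSigma_sq hεhat hα, ← mul_div_assoc, div_le_iff₀ hεhat]
  calc 2 * Real.log 2 * (3 * ptrOrder εhat δ + 2)
      ≤ 2 * Real.log (2 / δ) * (3 * ptrOrder εhat δ + 2) := by gcongr
    _ = (ptrOrder εhat δ - 1) * (3 * ptrOrder εhat δ + 2) * εhat := by
        rw [← ptrOrder_sub_one_mul hεhat.ne' δ]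
        ring

theorem ptrBeta_pos {εhat δ : ℝ} (hα : 0 < ptrOrder εhat δ) : 0 < ptrBeta εhat δ :=
  div_pos (by norm_num) hα

instance (εhat δ r s : ℝ) : IsProbabilityMeasure (ptrTest εhat δ r s) :=
  Measure.isProbabilityMeasure_map <| by
    unfold ptrUpper ptrMu
    fun_prop

/-- `μ` and `RDP + SS z_s` are independent and normal, and `RDP^upper` arises from them by the
invertible post-processing `(μ, x) ↦ (μ, x + c e^μ)`. -/
theorem ptrTest_eq_map_prod_gaussianReal (εhat δ r s : ℝ) :
    ptrTest εhat δ r s =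
      ((gaussianReal (Real.log s + √(2 * Real.log (2 / (δ / 2))) * ptrSigma εhat δ *
          ptrBeta εhat δ) (Real.toNNReal ((ptrBeta εhat δ * ptrSigma εhat δ) ^ 2))).prod
        (gaussianReal r (Real.toNNReal ((s * ptrSigma εhat δ) ^ 2)))).map
        fun w => (w.1, w.2 + ptrSigma εhat δ * √(2 * Real.log (2 / (δ / 2))) * Real.exp w.1) := by
  rw [← map_affine_normalNoise, ← map_affine_normalNoise, Measure.map_prod_map _ _ (by fun_prop)
    (by fun_prop), Measure.map_map (by fun_prop) (by fun_prop), ptrTest]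
  congr 1
  funext z
  simp only [ptrMu, ptrUpper, Function.comp_apply, Prod.map]
  ring_nf

theorem renyiBound_ptrTest_of_pos {εhat δ r r' s s' : ℝ} (hεhat : 0 < εhat) (hδ : 0 < δ)
    (hδ1 : δ ≤ 1) (hs : 0 < s) (hs' : 0 < s') (hr : |r - r'| ≤ s')
    (h : s ≤ Real.exp (ptrBeta εhat δ) * s') (h' : s' ≤ Real.exp (ptrBeta εhat δ) * s) :
    RenyiBound (ptrOrder εhat δ) (ptrTest εhat δ r s) (ptrTest εhat δ r' s') (εhat / 2) := by
  have hα := one_lt_ptrOrder hεhat hδ (hδ1.trans_lt one_lt_two)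
  have hα0 := zero_lt_one.trans hα
  have hσ := ptrSigma_pos hεhat hα0
  have hσ2 := ptrSigma_sq hεhat hα0
  have hβ := ptrBeta_pos hα0
  have hlog := abs_log_sub_log_le hs hs' h h'
  rw [ptrTest_eq_map_prod_gaussianReal, ptrTest_eq_map_prod_gaussianReal]
  generalize √(2 * Real.log (2 / (δ / 2))) = c
  set α := ptrOrder εhat δ with hαdef
  set σ := ptrSigma εhat δ
  set β := ptrBeta εhat δ with hβdef
  have hv : 0 < (β * σ) ^ 2 := by positivity
  have logMean : RenyiBound α
      (gaussianReal (Real.log s + c * σ * β) (Real.toNNReal ((β * σ) ^ 2)))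
      (gaussianReal (Real.log s' + c * σ * β) (Real.toNNReal ((β * σ) ^ 2)))
      (α / (2 * σ ^ 2)) := by
    refine (renyiBound_gaussianReal_same_variance hα _ _ (Real.toNNReal_pos.2 hv)).mono hα.le ?_
    have hsq : (Real.log s - Real.log s') ^ 2 ≤ β ^ 2 := sq_le_sq.2 (hlog.trans (le_abs_self β))
    rw [Real.coe_toNNReal _ hv.le, add_sub_add_right_eq_sub]
    calc α * (Real.log s - Real.log s') ^ 2 / (2 * (β * σ) ^ 2)
        ≤ α * β ^ 2 / (2 * (β * σ) ^ 2) := by gcongr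
      _ = α / (2 * σ ^ 2) := by field_simp
  have upper : RenyiBound α (gaussianReal r (Real.toNNReal ((s * σ) ^ 2)))
      (gaussianReal r' (Real.toNNReal ((s' * σ) ^ 2))) ((α + 1) / σ ^ 2) := by
    refine renyiBound_gaussianReal_mul_sq hα hσ hs hs' ?_ hr ?_
    · rw [abs_mul, abs_two]
      calc α * (2 * |Real.log s - Real.log s'|) ≤ α * (2 * β) := by gcongr
        _ = 2 / 5 := by rw [hβdef, ptrBeta, ← hαdef]; field_simp
    · exact two_mul_log_two_mul_ptrSigma_sq_le hεhat hδ hδ1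
  have hsum : εhat / 2 = α / (2 * σ ^ 2) + (α + 1) / σ ^ 2 := by
    rw [hσ2]
    field_simp
    ring
  rw [hsum]
  exact (logMean.prod hα0.le upper).map (ψ := fun w => (w.1, w.2 - σ * c * Real.exp w.1))
    (by fun_prop) (by fun_prop) fun w => by simp

theorem renyiBound_ptrTest {εhat δ r r' s s' : ℝ} (hεhat : 0 < εhat) (hδ : 0 < δ)
    (hδ1 : δ ≤ 1) (hr : |r - r'| ≤ s) (hr' : |r' - r| ≤ s')
    (h : s ≤ Real.exp (ptrBeta εhat δ) * s') (h' : s' ≤ Real.exp (ptrBeta εhat δ) * s) :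
    RenyiBound (ptrOrder εhat δ) (ptrTest εhat δ r s) (ptrTest εhat δ r' s') (εhat / 2) := by
  have hs : 0 ≤ s := (abs_nonneg _).trans hr
  have hs' : 0 ≤ s' := (abs_nonneg _).trans hr'
  rcases hs.eq_or_lt with rfl | hs
  · obtain rfl : s' = 0 := le_antisymm (by simpa using h') hs'
    obtain rfl : r = r' := sub_eq_zero.1 (abs_nonpos_iff.1 hr)
    exact (RenyiBound.refl _).mono (one_lt_ptrOrder hεhat hδ (hδ1.trans_lt one_lt_two)).le
      (half_pos hεhat).le
  · have hs'0 : 0 < s' := pos_of_mul_pos_right (hs.trans_le h) (Real.exp_nonneg _)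
    exact renyiBound_ptrTest_of_pos hεhat hδ hδ1 hs hs'0 (abs_sub_comm r r' ▸ hr') h h'

theorem le_ptrUpper {εhat δ s z₂ zs : ℝ} (r : ℝ) (hα : 0 ≤ ptrOrder εhat δ) (hs : 0 ≤ s)
    (hz₂ : -(√(2 * Real.log (2 / (δ / 2))) * ptrSigma εhat δ) ≤ z₂)
    (hzs : -(√(2 * Real.log (2 / (δ / 2))) * ptrSigma εhat δ) ≤ zs) :
    r ≤ ptrUpper εhat δ r s z₂ zs := by
  have hβ : 0 ≤ ptrBeta εhat δ := div_nonneg (by norm_num) hα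
  have hσ : 0 ≤ ptrSigma εhat δ := Real.sqrt_nonneg _
  have hμ : s ≤ Real.exp (ptrMu εhat δ s z₂) := (Real.le_exp_log s).trans <|
    Real.exp_le_exp.2 <| by
      unfold ptrMu
      nlinarith
  unfold ptrUpper
  set c := √(2 * Real.log (2 / (δ / 2)))
  have hcσ : 0 ≤ ptrSigma εhat δ * c := mul_nonneg hσ (Real.sqrt_nonneg _)
  calc r = r + s * -(c * ptrSigma εhat δ) + ptrSigma εhat δ * c * s := by ring
    _ ≤ _ := add_le_add (by gcongr) (mul_le_mul_of_nonneg_left hμ hcσ)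

theorem ptrTest_lt_le {εhat δ s : ℝ} (r : ℝ) (hεhat : 0 < εhat) (hδ : 0 < δ) (hδ2 : δ < 2)
    (hs : 0 ≤ s) : ptrTest εhat δ r s {w | w.2 < r} ≤ ENNReal.ofReal (δ / 2) := by
  have hα := zero_lt_one.trans (one_lt_ptrOrder hεhat hδ hδ2)
  set N := normalNoise (ptrSigma εhat δ)
  set I := Set.Iic (-(√(2 * Real.log (2 / (δ / 2))) * ptrSigma εhat δ))
  have tail : N I ≤ ENNReal.ofReal (2 / (δ / 2))⁻¹ :=
    normalNoise_Iic_sqrt_log_le (ptrSigma_pos hεhat hα) (by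
      rw [le_div_iff₀ (by positivity)]
      linarith)
  have cover : {z : ℝ × ℝ | ptrUpper εhat δ r s z.1 z.2 < r} ⊆
      I ×ˢ Set.univ ∪ Set.univ ×ˢ I := fun z hz => by
    by_contra hI
    simp only [I, Set.mem_union, Set.mem_prod, Set.mem_Iic, Set.mem_univ, and_true, true_and,
      not_or, not_le] at hI
    exact (le_ptrUpper r hα.le hs hI.1.le hI.2.le).not_gt hz
  rw [ptrTest, Measure.map_apply (by unfold ptrUpper ptrMu; fun_prop)
    (measurableSet_lt measurable_snd measurable_const)]
  calc N.prod N {z | ptrUpper εhat δ r s z.1 z.2 < r}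
      ≤ N.prod N (I ×ˢ Set.univ) + N.prod N (Set.univ ×ˢ I) :=
        (measure_mono cover).trans (measure_union_le _ _)
    _ ≤ ENNReal.ofReal (2 / (δ / 2))⁻¹ + ENNReal.ofReal (2 / (δ / 2))⁻¹ := by
        rw [Measure.prod_prod, Measure.prod_prod, measure_univ, mul_one, one_mul]
        gcongr
    _ = ENNReal.ofReal (δ / 2) := by
        rw [← ENNReal.ofReal_add (by positivity) (by positivity), inv_div]
        ring_nf

/-! ### Smooth sensitivity and the optimal RDP function -/

section SmoothSensitivity

variable {Z : Type*} {n : ℕ}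

theorem recordDist_comm (X Y : Fin n → Z) : recordDist X Y = recordDist Y X := by
  classical
  exact hammingDist_comm X Y

theorem recordDist_triangle (X Y W : Fin n → Z) :
    recordDist X W ≤ recordDist X Y + recordDist Y W := by
  classical
  exact hammingDist_triangle X Y W

theorem recordDist_self (X : Fin n → Z) : recordDist X X = 0 := by
  classical
  exact hammingDist_self X

theorem Neighbor.symm {X Y : Fin n → Z} (h : Neighbor X Y) : Neighbor Y X :=
  (recordDist_comm Y X).trans_le h

theorem Neighbor.refl (X : Fin n → Z) : Neighbor X X :=
  (recordDist_self X).trans_le zero_le_one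

theorem smoothSensitivity_le_exp_mul (β : ℝ) (f : (Fin n → Z) → ℝ) {X X' : Fin n → Z}
    (h : Neighbor X X') :
    smoothSensitivity β f X ≤ ENNReal.ofReal (Real.exp β) * smoothSensitivity β f X' := by
  refine iSup_le fun d => ?_
  have ball (Y : Fin n → Z) (hY : recordDist X Y ≤ d) : recordDist X' Y ≤ d + 1 := by
    have hX : recordDist X' X ≤ 1 := h.symm
    have := recordDist_triangle X' X Y
    omega
  have weight : ENNReal.ofReal (Real.exp (-(β * d)))
      = ENNReal.ofReal (Real.exp β) * ENNReal.ofReal (Real.exp (-(β * (d + 1 : ℕ)))) := by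
    rw [← ENNReal.ofReal_mul (Real.exp_nonneg _), ← Real.exp_add]
    push_cast
    ring_nf
  rw [weight, mul_assoc]
  gcongr
  refine le_iSup_of_le (d + 1) ?_
  gcongr
  exact iSup_const_mono (ball _)

theorem ofReal_abs_sub_le_smoothSensitivity (β : ℝ) (f : (Fin n → Z) → ℝ) {X X' : Fin n → Z}
    (h : Neighbor X X') : ENNReal.ofReal |f X - f X'| ≤ smoothSensitivity β f X :=
  calc ENNReal.ofReal |f X - f X'| ≤ localSensitivity f X :=
        le_iSup₂ (f := fun Y _ => ENNReal.ofReal |f X - f Y|) X' h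
    _ ≤ ⨆ (Y : Fin n → Z) (_ : recordDist X Y ≤ 0), localSensitivity f Y :=
        le_iSup₂_of_le X (recordDist_self X).le le_rfl
    _ ≤ smoothSensitivity β f X := le_iSup_of_le 0 (by simp)

theorem smoothSensitivity_ne_top {β : ℝ} (hβ : 0 ≤ β) {f : (Fin n → Z) → ℝ} {B : ℝ}
    (hB : ∀ X Y, |f X - f Y| ≤ B) (X : Fin n → Z) : smoothSensitivity β f X ≠ ∞ := by
  refine ne_top_of_le_ne_top (ENNReal.ofReal_ne_top (r := B))
    (iSup_le fun d => (mul_le_of_le_one_left' ?_).trans ?_)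
  · exact ENNReal.ofReal_le_one.2 (Real.exp_le_one_iff.2 (neg_nonpos.2 (by positivity)))
  · exact iSup₂_le fun Y _ => iSup₂_le fun Y' _ => ENNReal.ofReal_le_ofReal (hB Y Y')

theorem isSmoothSensitivityBound_smoothSensitivity {β : ℝ} (hβ : 0 ≤ β) {f : (Fin n → Z) → ℝ}
    {B : ℝ} (hB : ∀ X Y, |f X - f Y| ≤ B) :
    IsSmoothSensitivityBound β f fun X => (smoothSensitivity β f X).toReal := by
  refine ⟨fun X X' h => ?_, fun X X' h => ?_⟩
  · exact (ENNReal.ofReal_le_iff_le_toReal (smoothSensitivity_ne_top hβ hB X)).1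
      (ofReal_abs_sub_le_smoothSensitivity β f h)
  · have hle := ENNReal.toReal_mono (ENNReal.mul_ne_top ENNReal.ofReal_ne_top
      (smoothSensitivity_ne_top hβ hB X')) (smoothSensitivity_le_exp_mul β f h)
    rwa [ENNReal.toReal_mul, ENNReal.toReal_ofReal (Real.exp_nonneg _)] at hle

end SmoothSensitivity

theorem renyiDiv_ne_top_of_finite {S : Type*} [Finite S] [MeasurableSpace S]
    [MeasurableSingletonClass S] {α : ℝ} (hα : 1 < α) (P Q : Measure S) [SigmaFinite P]
    [IsFiniteMeasure Q] (hQ : ∀ x, Q {x} ≠ 0) : renyiDiv α P Q ≠ ⊤ := by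
  have := Fintype.ofFinite S
  have hPQ : P ≪ Q := Measure.ae_le_iff_absolutelyContinuous.1 (ae_eq_top.2 hQ ▸ le_top)
  have density_lt_top (x : S) : P.rnDeriv Q x < ∞ :=
    ae_iff_of_countable.1 (Measure.rnDeriv_lt_top P Q) x (hQ x)
  have moment_lt_top : ∫⁻ o, (P.rnDeriv Q o) ^ α ∂Q < ∞ := by
    rw [lintegral_fintype]
    exact ENNReal.sum_lt_top.2 fun x _ => ENNReal.mul_lt_top
      (ENNReal.rpow_lt_top_of_nonneg (by linarith) (density_lt_top x).ne) (measure_lt_top _ _)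
  have hα' : (0 : EReal) ≤ ((α - 1)⁻¹ : ℝ) :=
    EReal.coe_nonneg.2 (inv_nonneg.2 (sub_nonneg.2 hα.le))
  rw [renyiDiv, if_pos hPQ, EReal.mul_ne_top]
  exact ⟨.inl (EReal.coe_ne_bot _), .inl hα', .inl (EReal.coe_ne_top _),
    .inr (ENNReal.log_lt_top_iff.2 moment_lt_top).ne⟩

section OptimalRDP

variable {Z S : Type*} [MeasurableSpace S] {n : ℕ} {M : (Fin n → Z) → Measure S}

theorem exists_neighbor_renyiDiv_eq_iSup (hM : (Set.range M).Finite) (α : ℝ) (X : Fin n → Z) :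
    ∃ X', Neighbor X X' ∧
      renyiDiv α (M X) (M X') = ⨆ (Y : Fin n → Z) (_ : Neighbor X Y), renyiDiv α (M X) (M Y) := by
  have hfin : ((fun Y => renyiDiv α (M X) (M Y)) '' {Y | Neighbor X Y}).Finite :=
    (hM.image (renyiDiv α (M X))).subset (by rintro _ ⟨Y, -, rfl⟩; exact ⟨_, ⟨Y, rfl⟩, rfl⟩)
  have hne : {Y | Neighbor X Y}.Nonempty := ⟨X, Neighbor.refl X⟩
  have hmem := (hne.image fun Y => renyiDiv α (M X) (M Y)).csSup_mem hfin
  rwa [sSup_image] at hmem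

theorem isDataDependentRDP_optimalRDP {α : ℝ} (hM : (Set.range M).Finite)
    (htop : ∀ X X', renyiDiv α (M X) (M X') ≠ ⊤) :
    IsDataDependentRDP M α (optimalRDP M α) := fun X X' h => by
  obtain ⟨Y, -, hY⟩ := exists_neighbor_renyiDiv_eq_iSup hM α X
  calc renyiDiv α (M X) (M X')
      ≤ ⨆ (Y : Fin n → Z) (_ : Neighbor X Y), renyiDiv α (M X) (M Y) :=
        le_iSup₂ (f := fun Y _ => renyiDiv α (M X) (M Y)) X' h
    _ ≤ (optimalRDP M α X : EReal) := EReal.le_coe_toReal (hY ▸ htop X Y)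

theorem exists_abs_optimalRDP_sub_le (hM : (Set.range M).Finite) (α : ℝ) :
    ∃ B, ∀ X Y, |optimalRDP M α X - optimalRDP M α Y| ≤ B := by
  have hfin : (Set.range (optimalRDP M α)).Finite := by
    refine ((hM.image2 (renyiDiv α) hM).image EReal.toReal).subset ?_
    rintro _ ⟨X, rfl⟩
    obtain ⟨Y, -, hY⟩ := exists_neighbor_renyiDiv_eq_iSup hM α X
    exact ⟨_, ⟨_, ⟨X, rfl⟩, _, ⟨Y, rfl⟩, rfl⟩, congrArg EReal.toReal hY⟩
  obtain ⟨B, hB⟩ := Metric.isBounded_iff.1 hfin.isBounded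
  exact ⟨B, fun X Y => hB ⟨X, rfl⟩ ⟨Y, rfl⟩⟩

end OptimalRDP

/-! ### Noisy labels -/

theorem isOpenPosMeasure_normalNoise {σ : ℝ} (hσ : σ ≠ 0) :
    (normalNoise σ).IsOpenPosMeasure :=
  (gaussianReal_absolutelyContinuous' 0
    (Real.toNNReal_pos.2 (by positivity)).ne').isOpenPosMeasure

theorem argmaxLabel_eq_of_lt {C : ℕ} [NeZero C] {v : Fin C → ℝ} {j : Fin C}
    (h : ∀ k, k ≠ j → v k < v j) : argmaxLabel v = j := by
  have hmem : argmaxLabel v ∈ Finset.univ.filter fun j => ∀ k, v k ≤ v j :=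
    Finset.min'_mem _ _
  by_contra hne
  exact (h _ hne).not_ge ((Finset.mem_filter.1 hmem).2 j)

namespace PATE

variable {Z U Θ : Type*} [MeasurableSpace Θ] {n K T C : ℕ}

theorem finite_range_noisyLabels [NeZero C] (P : PATE Z U Θ n K T C) (σ₁ : ℝ) :
    (Set.range (P.noisyLabels σ₁)).Finite := by
  have hvotes (X x j) : P.votes X x j < K + 1 :=
    Nat.lt_succ_of_le ((Finset.card_le_univ _).trans_eq (Fintype.card_fin K))
  let law (v : Fin T → Fin C → Fin (K + 1)) : Measure (Fin T → Fin C) :=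
    (Measure.pi fun _ : Fin T => Measure.pi fun _ : Fin C => normalNoise σ₁).map
      fun g i => argmaxLabel fun j => ((v i j : ℕ) : ℝ) + g i j
  refine (Set.finite_range law).subset ?_
  rintro _ ⟨X, rfl⟩
  exact ⟨fun i j => ⟨P.votes X (P.query i) j, hvotes _ _ _⟩, rfl⟩

/-- The noises for which every query `i` has the label `y i` as its only noisy plurality label. -/
def strictWinners (P : PATE Z U Θ n K T C) (X : Fin n → Z) (y : Fin T → Fin C) :
    Set (Fin T → Fin C → ℝ) :=
  {g | ∀ i k, k ≠ y i →
    (P.votes X (P.query i) k : ℝ) + g i k < P.votes X (P.query i) (y i) + g i (y i)}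

theorem isOpen_strictWinners (P : PATE Z U Θ n K T C) (X : Fin n → Z) (y : Fin T → Fin C) :
    IsOpen (P.strictWinners X y) := by
  simp only [strictWinners, Set.ofPred_forall]
  exact isOpen_iInter_of_finite fun i => isOpen_iInter_of_finite fun k =>
    isOpen_iInter_of_finite fun _ => isOpen_lt (by fun_prop) (by fun_prop)

theorem nonempty_strictWinners (P : PATE Z U Θ n K T C) (X : Fin n → Z) (y : Fin T → Fin C) :
    (P.strictWinners X y).Nonempty :=
  ⟨fun i k => (if k = y i then 1 else 0) - P.votes X (P.query i) k, fun i k hk => by simp [hk]⟩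

theorem noisyLabels_singleton_ne_zero [NeZero C] (P : PATE Z U Θ n K T C) {σ₁ : ℝ} (hσ₁ : σ₁ ≠ 0)
    (X : Fin n → Z) (y : Fin T → Fin C) : P.noisyLabels σ₁ X {y} ≠ 0 := by
  have := isOpenPosMeasure_normalNoise hσ₁
  have : (Measure.pi fun _ : Fin C => normalNoise σ₁).IsOpenPosMeasure :=
    Measure.pi.isOpenPosMeasure _
  have : (Measure.pi fun _ : Fin T =>
      Measure.pi fun _ : Fin C => normalNoise σ₁).IsOpenPosMeasure :=
    Measure.pi.isOpenPosMeasure _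
  have hpos : 0 < (Measure.pi fun _ : Fin T => Measure.pi fun _ : Fin C => normalNoise σ₁)
      (P.strictWinners X y) :=
    (P.isOpen_strictWinners X y).measure_pos _ (P.nonempty_strictWinners X y)
  have hlabels : Measurable fun (g : Fin T → Fin C → ℝ) i =>
      argmaxLabel fun j => (P.votes X (P.query i) j : ℝ) + g i j :=
    measurable_pi_lambda _ fun i => measurable_argmaxLabel.comp (by fun_prop)
  rw [noisyLabels, Measure.map_apply hlabels (measurableSet_singleton y)]
  exact (hpos.trans_le (measure_mono fun g hg => funext fun i => argmaxLabel_eq_of_lt (hg i))).ne'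

theorem isDataDependentRDP_labelRDP [NeZero C] (P : PATE Z U Θ n K T C) {σ₁ εhat δ : ℝ}
    (hσ₁ : σ₁ ≠ 0) (hα : 1 < ptrOrder εhat δ) :
    IsDataDependentRDP (P.noisyLabels σ₁) (ptrOrder εhat δ) (P.labelRDP σ₁ εhat δ) :=
  isDataDependentRDP_optimalRDP (P.finite_range_noisyLabels σ₁) fun _ X' =>
    renyiDiv_ne_top_of_finite hα _ _ (P.noisyLabels_singleton_ne_zero hσ₁ X')

theorem isSmoothSensitivityBound_labelSS [NeZero C] (P : PATE Z U Θ n K T C) (σ₁ : ℝ)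
    {εhat δ : ℝ} (hα : 0 < ptrOrder εhat δ) :
    IsSmoothSensitivityBound (ptrBeta εhat δ) (P.labelRDP σ₁ εhat δ) (P.labelSS σ₁ εhat δ) := by
  obtain ⟨B, hB⟩ := exists_abs_optimalRDP_sub_le (P.finite_range_noisyLabels σ₁) (ptrOrder εhat δ)
  exact isSmoothSensitivityBound_smoothSensitivity (ptrBeta_pos hα).le hB

end PATE

/-! ### Privacy of the released values -/

theorem rdpToDP_ptrOrder {εhat δ : ℝ} (hα : 1 < ptrOrder εhat δ) (hεhat : εhat ≠ 0) (u : ℝ) :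
    rdpToDP (ptrOrder εhat δ) (δ / 2) u = u + εhat / 2 := by
  have hα' : ptrOrder εhat δ - 1 ≠ 0 := (sub_pos.2 hα).ne'
  have hlog := ptrOrder_sub_one_mul hεhat δ
  rw [rdpToDP, one_div_div, add_right_inj, div_eq_iff hα']
  linarith

theorem exp_ptrOrder_sub_one_mul_neg {εhat δ : ℝ} (hεhat : εhat ≠ 0) (hδ : 0 < δ) :
    Real.exp ((ptrOrder εhat δ - 1) * (εhat / 2 - εhat)) = δ / 2 := by
  have hlog : (ptrOrder εhat δ - 1) * (εhat / 2 - εhat) = -Real.log (2 / δ) := by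
    linarith [ptrOrder_sub_one_mul hεhat δ]
  rw [hlog, Real.exp_neg, Real.exp_log (by positivity), inv_div]

namespace PATE

variable {Z U Θ : Type*} [MeasurableSpace Θ] {n K T C : ℕ}

/-- Training of the student as a Markov kernel from the labels of the public points to the
models. -/
noncomputable def studentKernel (P : PATE Z U Θ n K T C) : Kernel (Fin T → Fin C) Θ :=
  Kernel.ofFunOfCountable fun y => P.student fun i => (P.query i, y i)

instance (P : PATE Z U Θ n K T C) : IsMarkovKernel P.studentKernel :=
  ⟨fun y => inferInstanceAs
    (IsProbabilityMeasure (P.student fun i => (P.query i, y i) : Measure Θ))⟩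

variable [NeZero C] {σ₁ ε' εhat δ : ℝ} {rdp SS : (Fin n → Z) → ℝ} {X X' : Fin n → Z}

theorem ptrTranscript_eq_map_bind (P : PATE Z U Θ n K T C) (σ₁ ε' εhat δ : ℝ)
    (rdp SS : (Fin n → Z) → ℝ) (X : Fin n → Z) :
    P.ptrTranscript σ₁ ε' εhat δ rdp SS X =
      (((ptrTest εhat δ (rdp X) (SS X)).prod (P.noisyLabels σ₁ X)).bind
        (Kernel.id ∥ₖ P.studentKernel)).map (ptrRelease ε' εhat δ) := by
  rw [← Measure.prod_comp_right]
  rfl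

/-- When the test would pass without noise, the test and the labels are released together and
everything else is post-processing. -/
theorem indistinguishable_ptrTranscript_of_le (P : PATE Z U Θ n K T C)
    (hα : 1 < ptrOrder εhat δ) (hεhat : 0 < εhat) (hδ : 0 < δ) (hX : rdp X + εhat / 2 ≤ ε')
    (htest : RenyiBound (ptrOrder εhat δ) (ptrTest εhat δ (rdp X) (SS X))
      (ptrTest εhat δ (rdp X') (SS X')) (εhat / 2))
    (hlabels : RenyiBound (ptrOrder εhat δ) (P.noisyLabels σ₁ X) (P.noisyLabels σ₁ X') (rdp X)) :
    Indistinguishable (ε' + εhat) (ENNReal.ofReal (δ / 2))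
      (P.ptrTranscript σ₁ ε' εhat δ rdp SS X) (P.ptrTranscript σ₁ ε' εhat δ rdp SS X') := by
  have joint := (htest.prod (by linarith) hlabels).mono (b' := ε' + εhat / 2) hα.le (by linarith)
  have release := ((joint.indistinguishable hα.le (ε' + εhat)).bind
    (Kernel.id ∥ₖ P.studentKernel)).map (measurable_ptrRelease ε' εhat δ)
  rwa [add_sub_add_left_eq_sub, exp_ptrOrder_sub_one_mul_neg hεhat.ne' hδ,
    ← ptrTranscript_eq_map_bind, ← ptrTranscript_eq_map_bind] at release

/-- When the test would fail without noise, it passes only if it underestimates the RDP function;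
otherwise the returned value is `⊥` and the transcript is determined by the test. -/
theorem indistinguishable_ptrTranscript_of_lt (P : PATE Z U Θ n K T C) (σ₁ : ℝ)
    (hεhat : 0 < εhat) (hδ : 0 < δ) (hδ2 : δ < 2) (hX : ε' < rdp X + εhat / 2) (hSS : 0 ≤ SS X)
    (htest : RenyiBound (ptrOrder εhat δ) (ptrTest εhat δ (rdp X) (SS X))
      (ptrTest εhat δ (rdp X') (SS X')) (εhat / 2)) :
    Indistinguishable εhat (ENNReal.ofReal δ)
      (P.ptrTranscript σ₁ ε' εhat δ rdp SS X) (P.ptrTranscript σ₁ ε' εhat δ rdp SS X') := by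
  have hα := one_lt_ptrOrder hεhat hδ hδ2
  have test := htest.indistinguishable hα.le εhat
  rw [exp_ptrOrder_sub_one_mul_neg hεhat.ne' hδ] at test
  let pass : Set (ℝ × ℝ) := {w | w.2 + εhat / 2 ≤ ε'}
  have hpass : MeasurableSet pass := measurableSet_le (by fun_prop) measurable_const
  have pass_le : ptrTest εhat δ (rdp X) (SS X) pass ≤ ENNReal.ofReal (δ / 2) :=
    (measure_mono fun w (hw : w ∈ pass) => lt_of_add_lt_add_right (hw.trans_lt hX)).trans
      (ptrTest_lt_le (rdp X) hεhat hδ hδ2 hSS)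
  have bot_of_fail (w : ℝ × ℝ) (hw : w ∉ pass) (θ : Θ) :
      ptrRelease ε' εhat δ (w, θ) = (w.1, w.2, Sum.inr ()) := by
    have hw' : ¬w.2 + εhat / 2 ≤ ε' := hw
    simp only [ptrRelease, rdpToDP_ptrOrder hα hεhat.ne', if_neg hw']
  have release := test.map_prod_of_determined (P.studentModel σ₁ X) (P.studentModel σ₁ X')
    (measurable_ptrRelease ε' εhat δ) (by fun_prop) hpass bot_of_fail pass_le
  rwa [← ENNReal.ofReal_add (by positivity) (by positivity), add_halves] at release

theorem isDP_ptrTranscript (P : PATE Z U Θ n K T C) (hε' : 0 ≤ ε') (hεhat : 0 < εhat)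
    (hδ : 0 < δ) (hδ1 : δ ≤ 1)
    (hrdp : IsDataDependentRDP (P.noisyLabels σ₁) (ptrOrder εhat δ) rdp)
    (hSS : IsSmoothSensitivityBound (ptrBeta εhat δ) rdp SS) :
    IsDP (P.ptrTranscript σ₁ ε' εhat δ rdp SS) (ε' + εhat) δ := fun X X' h => by
  have hδ2 : δ < 2 := hδ1.trans_lt one_lt_two
  have hα := one_lt_ptrOrder hεhat hδ hδ2
  have htest := renyiBound_ptrTest hεhat hδ hδ1 (hSS.1 X X' h) (hSS.1 X' X h.symm)
    (hSS.2 X X' h) (hSS.2 X' X h.symm)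
  rcases le_or_gt (rdp X + εhat / 2) ε' with hX | hX
  · have hlabels := RenyiBound.of_renyiDiv_le hα (hrdp X X' h)
    exact (P.indistinguishable_ptrTranscript_of_le hα hεhat hδ hX htest hlabels).mono le_rfl
      (ENNReal.ofReal_le_ofReal (half_le_self hδ.le))
  · have hSS0 : 0 ≤ SS X := (abs_nonneg _).trans (hSS.1 X X' h)
    exact (P.indistinguishable_ptrTranscript_of_lt σ₁ hεhat hδ hδ2 hX hSS0 htest).mono
      (le_add_of_nonneg_left hε') le_rfl

theorem isDP_ptr_of_isDP_ptrTranscript (P : PATE Z U Θ n K T C) {ε δ₀ : ℝ}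
    (h : IsDP (P.ptrTranscript σ₁ ε' εhat δ rdp SS) ε δ₀) :
    IsDP (P.ptr σ₁ ε' εhat δ rdp SS) ε δ₀ := fun X X' hX =>
  Indistinguishable.map (h X X' hX) (by fun_prop)

end PATE

/-- PATE with generalized PTR is `(ε' + ε̂, δ)`-DP: in its literal form, run with the data-dependent
RDP of the noisy labels and its smooth sensitivity, and for every data-dependent RDP function of the
noisy labels and every smooth sensitivity bound of it. In both cases this holds for the returned
value, and also when `μ` and `RDP^upper` are released along with it. -/
theorem theorem5p6 {Z U Θ : Type*} [MeasurableSpace Θ] {n K T C : ℕ} [NeZero C]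
    (P : PATE Z U Θ n K T C) (σ₁ ε' εhat δ : ℝ)
    (hσ₁ : 0 < σ₁) (hε' : 0 ≤ ε') (hεhat : 0 < εhat) (hδ : 0 < δ) (hδ1 : δ < 1) :
    (IsDP (P.ptr σ₁ ε' εhat δ (P.labelRDP σ₁ εhat δ) (P.labelSS σ₁ εhat δ)) (ε' + εhat) δ ∧
      IsDP (P.ptrTranscript σ₁ ε' εhat δ (P.labelRDP σ₁ εhat δ) (P.labelSS σ₁ εhat δ))
        (ε' + εhat) δ) ∧
    ∀ rdp SS : (Fin n → Z) → ℝ,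
      IsDataDependentRDP (P.noisyLabels σ₁) (ptrOrder εhat δ) rdp →
      IsSmoothSensitivityBound (ptrBeta εhat δ) rdp SS →
      IsDP (P.ptr σ₁ ε' εhat δ rdp SS) (ε' + εhat) δ ∧
        IsDP (P.ptrTranscript σ₁ ε' εhat δ rdp SS) (ε' + εhat) δ := by
  have hα := one_lt_ptrOrder hεhat hδ (hδ1.trans one_lt_two)
  have main (rdp SS : (Fin n → Z) → ℝ)
      (hrdp : IsDataDependentRDP (P.noisyLabels σ₁) (ptrOrder εhat δ) rdp)
      (hSS : IsSmoothSensitivityBound (ptrBeta εhat δ) rdp SS) :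
      IsDP (P.ptr σ₁ ε' εhat δ rdp SS) (ε' + εhat) δ ∧
        IsDP (P.ptrTranscript σ₁ ε' εhat δ rdp SS) (ε' + εhat) δ :=
    have transcript := P.isDP_ptrTranscript hε' hεhat hδ hδ1.le hrdp hSS
    ⟨P.isDP_ptr_of_isDP_ptrTranscript transcript, transcript⟩
  exact ⟨main _ _ (P.isDataDependentRDP_labelRDP hσ₁.ne' hα)
    (P.isSmoothSensitivityBound_labelSS σ₁ (zero_lt_one.trans hα)), main⟩
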